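/- Let $\rho$ be a finite non-negative Borel measure on $\mathbb{R}$ with compact support. In $L_2(\mathbb{R},\rho)$ let $(Af)(t)=tf(t)$ and let $B=(\cdot,g)g$, where $g\in L_2(\mathbb{R},\rho)$ and $g=1$ $\rho$-almost everywhere; put $A_\gamma=A+\gamma B$. Suppose that $\rho$ has the Borel transform boundedness (BTB) property: the function $\lambda\mapsto\int_{\mathbb{R}}\frac{\rho(dt)}{t-\lambda}$ is bounded on the upper half-plane $\{\operatorname{Im}\lambda>0\}$. Then $\rho$ is absolutely continuous with respect to Lebesgue measure, with an essentially bounded density $\tilde\rho$, and the following hold. (i) The pair $A,B$ has the functional holomorphy (FH) property: there is $\delta>0$ such that for every continuous $\varphi:\mathbb{R}\to\mathbb{C}$ the operator function $\gamma\mapsto\varphi(A_\gamma)$, $\gamma\in(-\delta,\delta)$, extends to a holomorphic function from the disk $\{\gamma\in\mathbb{C}:|\gamma|<\delta\}$ to the bounded operators on $L_2(\mathbb{R},\rho)$. (ii) Let $M>0$ be such that $\operatorname{supp}\rho\subset(-M,M)$. Then $\sigma(A_\gamma)\subset(-M,M)$ for all real $\gamma$ close enough to $0$, and for every continuous $\varphi:[-M,M]\to\mathbb{C}$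 the derivative along real $\gamma$, in the operator norm, exists and is $$\frac{\partial}{\partial\gamma}\varphi(A_\gamma)\Big|_{\gamma=0}=\pi i\,M_g\,[H,M_{\varphi_0}]\,M_{\bar g\tilde\rho}.$$ Here $\varphi_0$ is $\varphi$ extended by zero outside $[-M,M]$, and $M_h$ denotes multiplication by $h$, with $M_{\bar g\tilde\rho}:L_2(\mathbb{R},\rho)\to L_2(\mathbb{R})$, $M_{\varphi_0}:L_2(\mathbb{R})\to L_2(\mathbb{R})$ and $M_g:L_2(\mathbb{R})\to L_2(\mathbb{R},\rho)$. Further, $[H,M_{\varphi_0}]=HM_{\varphi_0}-M_{\varphi_0}H$ and $H=P_+-(I-P_+)$ is the Hilbert transform, where $P_+$ is the orthogonal projection of $L_2(\mathbb{R})$ onto the space of those $f$ for which $\hat f(\omega)=0$ for almost every $\omega<0$, with the Fourier transform $\hat f(\omega)=\int_{\mathbb{R}}f(x)e^{-2\pi i x\omega}\,dx$ (extended to $L_2(\mathbb{R})$). -/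

import Mathlib

open MeasureTheory FourierTransform Filter Topology
open scoped ENNReal NNReal

namespace GentlePert

/-! ### Functional calculus and functional holomorphy -/

section Abstract

variable {E : Type*} [NormedAddCommGroup E] [InnerProductSpace ℂ E] [CompleteSpace E]

/-- `φ(T)` for a bounded self-adjoint operator `T` and a function `φ : ℝ → ℂ` that is continuous on
the (real) spectrum of `T`: the continuous functional calculus of the normal operator `T`. -/
noncomputable def funOp (φ : ℝ → ℂ) (T : E →L[ℂ] E) : E →L[ℂ] E :=
  cfc (fun z : ℂ => φ z.re) T

/-- The perturbed operator `A_γ = A + γ B`. -/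
noncomputable def pert (A B : E →L[ℂ] E) (γ : ℂ) : E →L[ℂ] E := A + γ • B

/-- Functional Holomorphy of the pair `A, B`: for some `δ > 0`, for every continuous `φ : ℝ → ℂ`
the operator function `γ ↦ φ(A_γ)` on `(-δ, δ)` extends holomorphically (in the operator norm)
to the open disk of radius `δ`. -/
def HasFH (A B : E →L[ℂ] E) : Prop :=
  ∃ δ : ℝ, 0 < δ ∧ ∀ φ : ℝ → ℂ, Continuous φ →
    ∃ Φ : ℂ → (E →L[ℂ] E), DifferentiableOn ℂ Φ (Metric.ball 0 δ) ∧
      ∀ γ : ℝ, γ ∈ Set.Ioo (-δ) δ → Φ γ = funOp φ (pert A B γ)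

theorem pert_isSelfAdjoint {A B : E →L[ℂ] E} (hA : IsSelfAdjoint A) (hB : IsSelfAdjoint B)
    (γ : ℝ) : IsSelfAdjoint (pert A B (γ : ℂ)) :=
  hA.add (IsSelfAdjoint.smul (Complex.conj_ofReal γ) hB)

end Abstract

/-! ### Borel transform -/

/-- The Borel transform `∫ ρ(dt) / (t - z)`. -/
noncomputable def borelTransform (ρ : Measure ℝ) (z : ℂ) : ℂ := ∫ t : ℝ, ((t : ℂ) - z)⁻¹ ∂ρ

/-- Borel Transform Boundedness: the Borel transform is bounded in the upper half-plane (for a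
finite `ρ` it is automatically holomorphic there). -/
def HasBTB (ρ : Measure ℝ) : Prop := ∃ C : ℝ, ∀ z : ℂ, 0 < z.im → ‖borelTransform ρ z‖ ≤ C

/-! ### Riesz projection and Hilbert transform on `L²(ℝ)` -/

/-- The Hardy space of those `f ∈ L²(ℝ)` whose Fourier transform vanishes a.e. on `(-∞, 0)`. -/
noncomputable def hardyPlus : Submodule ℂ (Lp ℂ 2 (volume : Measure ℝ)) where
  carrier := {f | ∀ᵐ ω : ℝ, ω < 0 → (𝓕 f : Lp ℂ 2 (volume : Measure ℝ)) ω = 0}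
  zero_mem' := by
    have h0 : 𝓕 (0 : Lp ℂ 2 (volume : Measure ℝ)) = 0 :=
      (Lp.fourierTransformₗᵢ ℝ ℂ).map_zero
    change ∀ᵐ ω : ℝ, ω < 0 → (𝓕 (0 : Lp ℂ 2 (volume : Measure ℝ)) : Lp ℂ 2 volume) ω = 0
    rw [h0]
    filter_upwards [Lp.coeFn_zero ℂ 2 (volume : Measure ℝ)] with ω hω _
    rw [hω, Pi.zero_apply]
  add_mem' := by
    intro f f' hf hf'
    have h0 : 𝓕 (f + f') = 𝓕 f + 𝓕 f' := (Lp.fourierTransformₗᵢ ℝ ℂ).map_add f f'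
    change ∀ᵐ ω : ℝ, ω < 0 → (𝓕 (f + f') : Lp ℂ 2 (volume : Measure ℝ)) ω = 0
    rw [h0]
    filter_upwards [Lp.coeFn_add (𝓕 f) (𝓕 f'), hf, hf'] with ω h1 h2 h3 hω
    rw [h1, Pi.add_apply, h2 hω, h3 hω, add_zero]
  smul_mem' := by
    intro c f hf
    have h0 : 𝓕 (c • f) = c • 𝓕 f := (Lp.fourierTransformₗᵢ ℝ ℂ).map_smul c f
    change ∀ᵐ ω : ℝ, ω < 0 → (𝓕 (c • f) : Lp ℂ 2 (volume : Measure ℝ)) ω = 0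
    rw [h0]
    filter_upwards [Lp.coeFn_smul c (𝓕 f), hf] with ω h1 h2 hω
    rw [h1, Pi.smul_apply, h2 hω, smul_zero]

theorem hardyPlus_isClosed : IsClosed (hardyPlus : Set (Lp ℂ 2 (volume : Measure ℝ))) := by
  have key : (hardyPlus : Set (Lp ℂ 2 (volume : Measure ℝ))) =
      (fun f => LpToLpRestrictCLM ℝ ℂ ℂ volume 2 (Set.Iio 0)
        (Lp.fourierTransformₗᵢ ℝ ℂ f)) ⁻¹' {0} := by
    ext f
    change (∀ᵐ ω : ℝ, ω < 0 → (Lp.fourierTransformₗᵢ ℝ ℂ f) ω = 0) ↔ _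
    rw [Set.mem_preimage, Set.mem_singleton_iff, Lp.eq_zero_iff_ae_eq_zero]
    have h1 := LpToLpRestrictCLM_coeFn (p := 2) (μ := volume) ℂ (Set.Iio (0 : ℝ))
      (Lp.fourierTransformₗᵢ ℝ ℂ f)
    have h2 : (∀ᵐ ω : ℝ, ω < 0 → (Lp.fourierTransformₗᵢ ℝ ℂ f) ω = 0) ↔
        ∀ᵐ ω ∂(volume.restrict (Set.Iio (0 : ℝ))), (Lp.fourierTransformₗᵢ ℝ ℂ f) ω = 0 :=
      (ae_restrict_iff' measurableSet_Iio).symm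
    rw [h2]
    constructor
    · intro h
      exact h1.trans h
    · intro h
      exact h1.symm.trans h
  rw [key]
  exact isClosed_singleton.preimage
    ((LpToLpRestrictCLM ℝ ℂ ℂ volume 2 (Set.Iio 0)).continuous.comp
      (Lp.fourierTransformₗᵢ ℝ ℂ).continuous)

instance : CompleteSpace hardyPlus := hardyPlus_isClosed.completeSpace_coe

/-- The Riesz projection `P₊`: the orthogonal projection of `L²(ℝ)` onto the Hardy space. -/
noncomputable def rieszProj :
    Lp ℂ 2 (volume : Measure ℝ) →L[ℂ] Lp ℂ 2 (volume : Measure ℝ) :=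
  hardyPlus.starProjection

/-- The Hilbert transform `H = P₊ - P₋`, where `P₋ = I - P₊`. -/
noncomputable def hilbertTransform :
    Lp ℂ 2 (volume : Measure ℝ) →L[ℂ] Lp ℂ 2 (volume : Measure ℝ) :=
  rieszProj - (1 - rieszProj)

/-! ### Multiplication operators -/

/-- `T` is the operator of multiplication by `h` from `L²(μ)` to `L²(ν)`: for every function `f`
that is square-integrable for `μ`, `T` sends the `μ`-class of `f` to the `ν`-class of `h f`. -/
def IsMulOp (μ ν : Measure ℝ) (h : ℝ → ℂ) (T : Lp ℂ 2 μ →L[ℂ] Lp ℂ 2 ν) : Prop :=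
  ∀ (f : ℝ → ℂ) (hf : MemLp f 2 μ), T (hf.toLp f) =ᵐ[ν] fun x => h x * f x

open Classical in
/-- The operator `M_h` of multiplication by `h` from `L²(μ)` to `L²(ν)`, whenever this is a
well-defined bounded operator (and `0` otherwise; see the existence theorems below). -/
noncomputable def mulOp (μ ν : Measure ℝ) (h : ℝ → ℂ) : Lp ℂ 2 μ →L[ℂ] Lp ℂ 2 ν :=
  if H : ∃ T : Lp ℂ 2 μ →L[ℂ] Lp ℂ 2 ν, IsMulOp μ ν h T then H.choose else 0

theorem IsMulOp.unique {μ ν : Measure ℝ} {h : ℝ → ℂ} {S T : Lp ℂ 2 μ →L[ℂ] Lp ℂ 2 ν}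
    (hS : IsMulOp μ ν h S) (hT : IsMulOp μ ν h T) : S = T := by
  ext1 f
  have hf := Lp.memLp f
  rw [← Lp.toLp_coeFn f hf]
  exact Lp.ext ((hS f hf).trans (hT f hf).symm)

theorem isMulOp_mulOp_of_exists {μ ν : Measure ℝ} {h : ℝ → ℂ}
    (H : ∃ T : Lp ℂ 2 μ →L[ℂ] Lp ℂ 2 ν, IsMulOp μ ν h T) : IsMulOp μ ν h (mulOp μ ν h) := by
  rw [mulOp, dif_pos H]
  exact H.choose_spec

theorem isMulOp_mulOp_of_bound {μ ν : Measure ℝ} {h : ℝ → ℂ} (C : ℝ≥0)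
    (H : ∀ f : ℝ → ℂ, MemLp f 2 μ → AEStronglyMeasurable (fun x => h x * f x) ν ∧
      eLpNorm (fun x => h x * f x) 2 ν ≤ C * eLpNorm f 2 μ) :
    IsMulOp μ ν h (mulOp μ ν h) := by
  have hmem : ∀ f : ℝ → ℂ, MemLp f 2 μ → MemLp (fun x => h x * f x) 2 ν := fun f hf =>
    ⟨(H f hf).1, (H f hf).2.trans_lt (ENNReal.mul_lt_top ENNReal.coe_lt_top hf.2)⟩
  have hcongr : ∀ f f' : ℝ → ℂ, MemLp f 2 μ → MemLp f' 2 μ → f =ᵐ[μ] f' →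
      (fun x => h x * f x) =ᵐ[ν] fun x => h x * f' x := by
    intro f f' hf hf' hff'
    have h1 := H (f - f') (hf.sub hf')
    have h2 : eLpNorm (f - f') 2 μ = 0 := by
      rw [eLpNorm_eq_zero_iff (hf.sub hf').1 (by norm_num)]
      filter_upwards [hff'] with x hx
      simp [hx]
    have h3 : eLpNorm (fun x => h x * (f - f') x) 2 ν = 0 := by
      have := h1.2
      rw [h2, mul_zero] at this
      exact le_antisymm this bot_le
    rw [eLpNorm_eq_zero_iff h1.1 (by norm_num)] at h3
    filter_upwards [h3] with x hx
    have : h x * f x - h x * f' x = 0 := by simpa [mul_sub] using hx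
    exact sub_eq_zero.mp this
  let L : Lp ℂ 2 μ →ₗ[ℂ] Lp ℂ 2 ν :=
    { toFun := fun f => (hmem f (Lp.memLp f)).toLp _
      map_add' := by
        intro f f'
        apply Lp.ext
        refine (MemLp.coeFn_toLp _).trans ?_
        refine (hcongr _ _ (Lp.memLp _) ((Lp.memLp f).add (Lp.memLp f'))
          (Lp.coeFn_add f f')).trans ?_
        refine EventuallyEq.trans ?_ (Lp.coeFn_add _ _).symm
        filter_upwards [(hmem f (Lp.memLp f)).coeFn_toLp, (hmem f' (Lp.memLp f')).coeFn_toLp]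
          with x h1 h2
        simp [h1, h2, mul_add]
      map_smul' := by
        intro c f
        apply Lp.ext
        refine (MemLp.coeFn_toLp _).trans ?_
        refine (hcongr _ _ (Lp.memLp _) ((Lp.memLp f).const_smul c) (Lp.coeFn_smul c f)).trans ?_
        refine EventuallyEq.trans ?_ (Lp.coeFn_smul _ _).symm
        filter_upwards [(hmem f (Lp.memLp f)).coeFn_toLp] with x h1
        simp [h1, mul_left_comm] }
  have hL : ∀ f, ‖L f‖ ≤ C * ‖f‖ := by
    intro f
    change ‖(hmem f (Lp.memLp f)).toLp _‖ ≤ _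
    rw [Lp.norm_toLp, Lp.norm_def]
    have h1 := ENNReal.toReal_mono
      (ENNReal.mul_lt_top ENNReal.coe_lt_top (Lp.memLp f).2).ne (H f (Lp.memLp f)).2
    simpa [ENNReal.toReal_mul] using h1
  refine isMulOp_mulOp_of_exists ⟨L.mkContinuous C hL, ?_⟩
  intro f hf
  change ((hmem (hf.toLp f) (Lp.memLp _)).toLp _ : ℝ → ℂ) =ᵐ[ν] _
  exact (MemLp.coeFn_toLp _).trans (hcongr _ _ (Lp.memLp _) hf hf.coeFn_toLp)

/-- Multiplication by an essentially bounded function acts in `L²(μ)`. -/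
theorem isMulOp_mulOp {μ : Measure ℝ} {h : ℝ → ℂ} (hm : AEStronglyMeasurable h μ) (C : ℝ≥0)
    (hC : ∀ᵐ x ∂μ, ‖h x‖₊ ≤ C) : IsMulOp μ μ h (mulOp μ μ h) := by
  refine isMulOp_mulOp_of_bound C fun f hf => ⟨hm.mul hf.1, ?_⟩
  have := eLpNorm_le_nnreal_smul_eLpNorm_of_ae_le_mul (f := fun x => h x * f x) (g := f)
    (c := C) (μ := μ) (by
      filter_upwards [hC] with x hx
      rw [nnnorm_mul]
      gcongr) 2
  simpa [ENNReal.smul_def] using this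

/-! ### The operator of multiplication by the independent variable -/

/-- `(A f)(t) = t f(t)` in `L²(ρ)`. -/
noncomputable def posOp (ρ : Measure ℝ) : Lp ℂ 2 ρ →L[ℂ] Lp ℂ 2 ρ :=
  mulOp ρ ρ (fun t : ℝ => (t : ℂ))

theorem isMulOp_posOp {ρ : Measure ℝ} (hρ : IsCompact ρ.support) :
    IsMulOp ρ ρ (fun t : ℝ => (t : ℂ)) (posOp ρ) := by
  obtain ⟨C, hC⟩ := hρ.isBounded.exists_norm_le
  refine isMulOp_mulOp Complex.continuous_ofReal.aestronglyMeasurable C.toNNReal ?_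
  filter_upwards [Measure.support_mem_ae (μ := ρ)] with t ht
  have := hC t ht
  rw [← NNReal.coe_le_coe, coe_nnnorm, Complex.norm_real]
  exact this.trans (Real.le_coe_toNNReal C)

theorem isSelfAdjoint_posOp {ρ : Measure ℝ} (hρ : IsCompact ρ.support) :
    IsSelfAdjoint (posOp ρ) := by
  rw [ContinuousLinearMap.isSelfAdjoint_iff_isSymmetric]
  intro f f'
  have key : ∀ f : Lp ℂ 2 ρ, posOp ρ f =ᵐ[ρ] fun t => (t : ℂ) * f t := by
    intro f
    have := isMulOp_posOp hρ f (Lp.memLp f)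
    rwa [Lp.toLp_coeFn] at this
  change inner ℂ (posOp ρ f) f' = inner ℂ f (posOp ρ f')
  rw [L2.inner_def, L2.inner_def]
  refine integral_congr_ae ?_
  filter_upwards [key f, key f'] with t h1 h2
  rw [h1, h2]
  simp [RCLike.inner_apply]
  ring

/-- The rank-one operator `B = (·, g) g`. -/
noncomputable def rankOnePert {ρ : Measure ℝ} (g : Lp ℂ 2 ρ) : Lp ℂ 2 ρ →L[ℂ] Lp ℂ 2 ρ :=
  InnerProductSpace.rankOne ℂ g g

theorem isSelfAdjoint_rankOnePert {ρ : Measure ℝ} (g : Lp ℂ 2 ρ) :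
    IsSelfAdjoint (rankOnePert g) := by
  rw [ContinuousLinearMap.isSelfAdjoint_iff_isSymmetric]
  exact InnerProductSpace.isSymmetric_rankOne_self g

/-! ### The density of `ρ` and the operators between `L²(ρ)` and `L²(ℝ)` -/

/-- The density of (the absolutely continuous part of) `ρ`, as a real-valued function. -/
noncomputable def density (ρ : Measure ℝ) (x : ℝ) : ℝ := (ρ.rnDeriv volume x).toReal

/-- `ρ` is absolutely continuous with an essentially bounded density. -/
def HasBoundedDensity (ρ : Measure ℝ) : Prop :=
  ρ ≪ volume ∧ ∃ C : ℝ, ∀ᵐ x : ℝ, density ρ x ≤ C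

theorem HasBoundedDensity.exists_eq {ρ : Measure ℝ} [IsFiniteMeasure ρ]
    (h : HasBoundedDensity ρ) : ∃ r : ℝ → ℝ≥0, Measurable r ∧ (∃ C : ℝ≥0, ∀ᵐ x : ℝ, r x ≤ C) ∧
      (∀ x, (r x : ℝ) = density ρ x) ∧ ρ = volume.withDensity (fun x => (r x : ℝ≥0∞)) := by
  obtain ⟨hac, C, hC⟩ := h
  refine ⟨fun x => (ρ.rnDeriv volume x).toNNReal,
    (Measure.measurable_rnDeriv ρ volume).ennreal_toNNReal, ⟨C.toNNReal, ?_⟩, fun x => rfl, ?_⟩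
  · filter_upwards [hC] with x hx
    rw [← NNReal.coe_le_coe]
    exact le_trans hx (Real.le_coe_toNNReal C)
  · conv_lhs => rw [← Measure.withDensity_rnDeriv_eq ρ volume hac]
    refine withDensity_congr_ae ?_
    filter_upwards [Measure.rnDeriv_lt_top ρ volume] with x hx
    exact (ENNReal.coe_toNNReal hx.ne).symm

/-- For a bounded density, multiplication by an essentially bounded function maps `L²(ℝ)` into
`L²(ρ)`. -/
theorem isMulOp_mulOp_to {ρ : Measure ℝ} [IsFiniteMeasure ρ] (hρ : HasBoundedDensity ρ)
    {h : ℝ → ℂ} (hm : AEStronglyMeasurable h ρ) (K : ℝ≥0) (hK : ∀ᵐ x ∂ρ, ‖h x‖₊ ≤ K) :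
    IsMulOp volume ρ h (mulOp volume ρ h) := by
  obtain ⟨r, hr, ⟨C, hC⟩, -, heq⟩ := hρ.exists_eq
  have hle : ρ ≤ (C : ℝ≥0∞) • (volume : Measure ℝ) := by
    rw [heq, ← withDensity_const]
    refine withDensity_mono ?_
    filter_upwards [hC] with x hx
    exact_mod_cast hx
  refine isMulOp_mulOp_of_bound (K * (C ^ (1 / 2 : ℝ))) fun f hf => ?_
  have hf' : AEStronglyMeasurable f ρ := hf.1.mono_ac hρ.1
  refine ⟨hm.mul hf', ?_⟩
  have h1 := eLpNorm_le_nnreal_smul_eLpNorm_of_ae_le_mul (f := fun x => h x * f x) (g := f)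
    (c := K) (μ := ρ) (by
      filter_upwards [hK] with x hx
      rw [nnnorm_mul]
      gcongr) 2
  have h2 : eLpNorm f 2 ρ ≤ (C : ℝ≥0∞) ^ (1 / 2 : ℝ) * eLpNorm f 2 volume := by
    refine (eLpNorm_mono_measure f hle).trans ?_
    rw [eLpNorm_smul_measure_of_ne_top (by norm_num)]
    simp
  calc _ ≤ (K : ℝ≥0∞) * eLpNorm f 2 ρ := by simpa [ENNReal.smul_def] using h1
    _ ≤ (K : ℝ≥0∞) * ((C : ℝ≥0∞) ^ (1 / 2 : ℝ) * eLpNorm f 2 volume) := by gcongr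
    _ = _ := by
      rw [ENNReal.coe_mul, ENNReal.coe_rpow_of_nonneg _ (by norm_num), mul_assoc]

/-- For a bounded density `ρ̃`, multiplication by `k ρ̃` with an essentially bounded `k` maps
`L²(ρ)` into `L²(ℝ)`. -/
theorem isMulOp_mulOp_from {ρ : Measure ℝ} [IsFiniteMeasure ρ] (hρ : HasBoundedDensity ρ)
    {k : ℝ → ℂ} (hm : AEStronglyMeasurable k ρ) (K : ℝ≥0) (hK : ∀ᵐ x ∂ρ, ‖k x‖₊ ≤ K) :
    IsMulOp ρ volume (fun x => k x * (density ρ x : ℂ))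
      (mulOp ρ volume (fun x => k x * (density ρ x : ℂ))) := by
  obtain ⟨r, hr, ⟨C, hC⟩, hrd, heq⟩ := hρ.exists_eq
  have hrm : Measurable fun x => (r x : ℝ≥0∞) := hr.coe_nnreal_ennreal
  refine isMulOp_mulOp_of_bound (K * (C ^ (1 / 2 : ℝ))) fun f hf => ?_
  have hform : (fun x => k x * (density ρ x : ℂ) * f x) =
      fun x => (r x : ℝ) • (k x * f x) := by
    funext x
    rw [← hrd x, Complex.real_smul]
    ring
  have hkf : AEStronglyMeasurable (fun x => k x * f x) ρ := hm.mul hf.1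
  have hmeas : AEStronglyMeasurable (fun x => (r x : ℝ) • (k x * f x)) volume := by
    rw [heq] at hkf
    exact (aestronglyMeasurable_withDensity_iff hr).mp hkf
  rw [hform]
  refine ⟨hmeas, ?_⟩
  have h1 := eLpNorm_le_nnreal_smul_eLpNorm_of_ae_le_mul (f := fun x => k x * f x) (g := f)
    (c := K) (μ := ρ) (by
      filter_upwards [hK] with x hx
      rw [nnnorm_mul]
      gcongr) 2
  have h2 : eLpNorm (fun x => (r x : ℝ) • (k x * f x)) 2 volume ≤
      (C : ℝ≥0∞) ^ (1 / 2 : ℝ) * eLpNorm (fun x => k x * f x) 2 ρ := by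
    have hpow : ∀ (u : ℝ → ℂ) (μ : Measure ℝ),
        eLpNorm u 2 μ = (∫⁻ x, ‖u x‖ₑ ^ (2 : ℝ) ∂μ) ^ (1 / 2 : ℝ) := by
      intro u μ
      rw [eLpNorm_eq_lintegral_rpow_enorm_toReal (by norm_num) (by norm_num)]
      simp
    rw [hpow, hpow, ← ENNReal.mul_rpow_of_nonneg _ _ (by norm_num)]
    refine ENNReal.rpow_le_rpow ?_ (by norm_num)
    have h3 : ∫⁻ x, ‖k x * f x‖ₑ ^ (2 : ℝ) ∂ρ =
        ∫⁻ x, (r x : ℝ≥0∞) * ‖k x * f x‖ₑ ^ (2 : ℝ) := by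
      have hae : AEMeasurable (fun x => ‖k x * f x‖ₑ ^ (2 : ℝ)) ρ := hkf.enorm.pow_const _
      rw [heq] at hae
      conv_lhs => rw [heq]
      rw [lintegral_withDensity_eq_lintegral_mul₀' hrm.aemeasurable hae]
      rfl
    rw [h3, ← lintegral_const_mul' _ _ ENNReal.coe_ne_top]
    refine lintegral_mono_ae ?_
    filter_upwards [hC] with x hx
    have h4 : ‖(r x : ℝ) • (k x * f x)‖ₑ = (r x : ℝ≥0∞) * ‖k x * f x‖ₑ := by
      rw [enorm_smul]
      congr 1
      simp [enorm_eq_nnnorm]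
    rw [h4, ENNReal.mul_rpow_of_nonneg _ _ (by norm_num), ← mul_assoc]
    gcongr
    rw [ENNReal.rpow_two, sq]
    gcongr
  calc _ ≤ _ := h2
    _ ≤ (C : ℝ≥0∞) ^ (1 / 2 : ℝ) * ((K : ℝ≥0∞) * eLpNorm f 2 ρ) := by
      gcongr
      simpa [ENNReal.smul_def] using h1
    _ = _ := by
      rw [ENNReal.coe_mul, ENNReal.coe_rpow_of_nonneg _ (by norm_num)]
      ring

/-- The continuation `φ₀` of `φ` by zero outside `[-M, M]`. -/
noncomputable def zeroExt (M : ℝ) (φ : ℝ → ℂ) : ℝ → ℂ := (Set.Icc (-M) M).indicator φ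

/-- `M_{φ₀}` acts in `L²(ℝ)`. -/
theorem isMulOp_zeroExt {M : ℝ} {φ : ℝ → ℂ} (hφ : ContinuousOn φ (Set.Icc (-M) M)) :
    IsMulOp volume volume (zeroExt M φ) (mulOp volume volume (zeroExt M φ)) := by
  obtain ⟨C, hC⟩ := isCompact_Icc.exists_bound_of_continuousOn hφ
  refine isMulOp_mulOp ?_ C.toNNReal (ae_of_all _ fun x => ?_)
  · rw [zeroExt, aestronglyMeasurable_indicator_iff measurableSet_Icc]
    exact hφ.aestronglyMeasurable measurableSet_Icc
  · by_cases hx : x ∈ Set.Icc (-M) M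
    · rw [zeroExt, Set.indicator_of_mem hx, ← NNReal.coe_le_coe]
      exact (hC x hx).trans (Real.le_coe_toNNReal C)
    · simp [zeroExt, Set.indicator_of_notMem hx]

/-- The operator `π i M_g [H, M_{φ₀}] M_{ḡ ρ̃}` in `L²(ρ)`. Here `M_{ḡ ρ̃}` acts from `L²(ρ)` to
`L²(ℝ)`, the commutator acts in `L²(ℝ)`, and `M_g` acts from `L²(ℝ)` to `L²(ρ)`. -/
noncomputable def derivOp (ρ : Measure ℝ) (g : ℝ → ℂ) (M : ℝ) (φ : ℝ → ℂ) :
    Lp ℂ 2 ρ →L[ℂ] Lp ℂ 2 ρ :=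
  ((Real.pi : ℂ) * Complex.I) •
    (mulOp volume ρ g ∘L
      (hilbertTransform ∘L mulOp volume volume (zeroExt M φ) -
        mulOp volume volume (zeroExt M φ) ∘L hilbertTransform) ∘L
      mulOp ρ volume (fun x => star (g x) * (density ρ x : ℂ)))

end GentlePert

namespace GentlePert

/-! ### Functional calculus of similar operators -/

/-! The perturbation is undone by a similarity that is affine in `γ`. If a bounded `N` satisfies `NA
- AN = -B` and `NB = 0`, then `(1 + γN)(A + γB) = A(1 + γN)`, so for small real `γ` one has `φ(A_γ)
= (1 + γN)⁻¹ φ(A) (1 + γN)`. The right side makes sense and is holomorphic for small complex `γ`,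
and its derivative at `0` is `φ(A)N - Nφ(A)`. This is `hasFH_of_commutator` and
`hasDerivAt_funOp_pert`.

Such an `N` comes from Cauchy integrals. Let `K f` be the boundary value from above of `∫ f(t) ρ(dt)
/ (t - z)`. The identity `t/(t - z) = 1 + z/(t - z)` gives `KA = AK + B` (`cauchyOp_posOp`). To
achieve `NB = 0`, one subtracts `K` from the operator `D` of multiplication by `K g`: it commutes
with `A`, and `Dg = Kg` because `g = 1`. Thus `N = D - K`. BTB enters twice: it bounds the density,
which makes `K` bounded (`HasBTB.hasBoundedDensity`), and it bounds the function `K g`, which makes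
`D` bounded (`ae_norm_cauchyOp_le`).

As `D` commutes with `φ(A)`, the derivative is `Kφ(A) - φ(A)K`. By Sokhotski's formula
(`exists_subseq_tendsto_cauchy`), `K = 2πi M_g P₊ M_{ḡρ̃}`, and `H = 2P₊ - 1` turns this commutator
into the stated one (`derivOp_eq`). -/

theorem exists_polynomial_norm_sub_le {a b : ℝ} {φ : ℝ → ℂ} (hφ : ContinuousOn φ (Set.Icc a b))
    {ε : ℝ} (hε : 0 < ε) :
    ∃ p : Polynomial ℂ, ∀ x ∈ Set.Icc a b, ‖p.eval (x : ℂ) - φ x‖ ≤ ε := by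
  obtain ⟨p, hp⟩ := exists_polynomial_near_of_continuousOn a b (fun x => (φ x).re)
    (Complex.continuous_re.comp_continuousOn hφ) (ε / 2) (half_pos hε)
  obtain ⟨q, hq⟩ := exists_polynomial_near_of_continuousOn a b (fun x => (φ x).im)
    (Complex.continuous_im.comp_continuousOn hφ) (ε / 2) (half_pos hε)
  refine ⟨p.map Complex.ofRealHom + Polynomial.C Complex.I * q.map Complex.ofRealHom,
    fun x hx => ?_⟩
  have hev : ∀ r : Polynomial ℝ,
      (r.map Complex.ofRealHom).eval (x : ℂ) = ((r.eval x : ℝ) : ℂ) := fun r => by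
    rw [← Complex.ofRealHom_eq_coe, Polynomial.eval_map_apply]
    rfl
  have h1 : Polynomial.eval (x : ℂ)
      (p.map Complex.ofRealHom + Polynomial.C Complex.I * q.map Complex.ofRealHom) - φ x =
      ((p.eval x - (φ x).re : ℝ) : ℂ) + Complex.I * ((q.eval x - (φ x).im : ℝ) : ℂ) := by
    rw [Polynomial.eval_add, Polynomial.eval_mul, Polynomial.eval_C, hev, hev]
    conv_lhs => rw [← Complex.re_add_im (φ x)]
    push_cast
    ring
  rw [h1]
  refine (norm_add_le _ _).trans ?_
  rw [norm_mul, Complex.norm_I, one_mul, Complex.norm_real, Complex.norm_real]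
  have h2 := hp x hx
  have h3 := hq x hx
  rw [Real.norm_eq_abs, Real.norm_eq_abs]
  linarith

section Abstract

variable {E : Type*} [NormedAddCommGroup E] [InnerProductSpace ℂ E]

variable {A B N : E →L[ℂ] E}

theorem aeval_intertwine {T S V : E →L[ℂ] E} (h : V * T = S * V) (p : Polynomial ℂ) :
    V * Polynomial.aeval T p = Polynomial.aeval S p * V := by
  have h' : SemiconjBy V T S := h
  induction p using Polynomial.induction_on' with
  | add p q hp hq => rw [map_add, map_add, mul_add, add_mul, hp, hq]
  | monomial n c =>
    rw [Polynomial.aeval_monomial, Polynomial.aeval_monomial, ← mul_assoc,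
      ← Algebra.commutes, mul_assoc, (h'.pow_right n).eq, mul_assoc]

/-- The affine operator function `1 + γ N` intertwines `A + γ B` with `A`. -/
theorem one_add_smul_mul_pert (hNA : N * A - A * N = -B) (hNB : N * B = 0) (γ : ℂ) :
    (1 + γ • N) * pert A B γ = A * (1 + γ • N) := by
  have h : N * A = A * N - B := by rw [sub_eq_iff_eq_add.mp hNA]; abel
  rw [pert, add_mul, one_mul, mul_add, smul_mul_assoc, smul_mul_assoc, mul_smul_comm, hNB,
    smul_zero, smul_zero, add_zero, mul_add, mul_one, mul_smul_comm, h, smul_sub]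
  abel

theorem eventually_norm_ofReal_lt (N : E →L[ℂ] E) :
    ∀ᶠ γ : ℝ in 𝓝 0, ‖(γ : ℂ)‖ < 1 / (‖N‖ + 1) := by
  have h : Tendsto (fun γ : ℝ => ‖(γ : ℂ)‖) (𝓝 0) (𝓝 0) := by
    have : Continuous fun γ : ℝ => ‖(γ : ℂ)‖ := by fun_prop
    simpa using this.tendsto 0
  exact h.eventually_lt_const (by positivity)

variable [CompleteSpace E]

/-- The calculus is isometric up to sup norms on the spectrum. Approximating on an interval
containing the spectrum lets one polynomial serve two operators at once. -/
theorem norm_funOp_sub_aeval_le {T : E →L[ℂ] E} (hT : IsSelfAdjoint T) {a b : ℝ}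
    (hσ : spectrum ℂ T ⊆ (fun t : ℝ => (t : ℂ)) '' Set.Icc a b) {φ : ℝ → ℂ}
    (hφ : ContinuousOn φ (Set.Icc a b)) {p : Polynomial ℂ} {ε : ℝ} (hε : 0 ≤ ε)
    (hp : ∀ x ∈ Set.Icc a b, ‖p.eval (x : ℂ) - φ x‖ ≤ ε) :
    ‖funOp φ T - Polynomial.aeval T p‖ ≤ ε := by
  have hn : IsStarNormal T := hT.isStarNormal
  have hc : ContinuousOn (fun z : ℂ => φ z.re) (spectrum ℂ T) := by
    refine hφ.comp Complex.continuous_re.continuousOn fun z hz => ?_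
    obtain ⟨t, ht, rfl⟩ := hσ hz
    exact ht
  rw [funOp, ← cfc_polynomial p T, ← cfc_sub _ _ T hc p.continuous.continuousOn]
  refine norm_cfc_le hε fun z hz => ?_
  obtain ⟨t, ht, rfl⟩ := hσ hz
  rw [norm_sub_rev]
  exact hp t ht

/-- An operator intertwining two self-adjoint operators intertwines their functions. -/
theorem funOp_intertwine {T S V : E →L[ℂ] E} (hT : IsSelfAdjoint T) (hS : IsSelfAdjoint S)
    (h : V * T = S * V) {a b : ℝ} (hσT : spectrum ℂ T ⊆ (fun t : ℝ => (t : ℂ)) '' Set.Icc a b)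
    (hσS : spectrum ℂ S ⊆ (fun t : ℝ => (t : ℂ)) '' Set.Icc a b) {φ : ℝ → ℂ}
    (hφ : ContinuousOn φ (Set.Icc a b)) : V * funOp φ T = funOp φ S * V := by
  rw [← sub_eq_zero, ← norm_le_zero_iff]
  refine le_of_forall_pos_le_add fun ε hε => ?_
  -- Two error terms, each at most `‖V‖` times the tolerance; the `+ 1` covers `V = 0`.
  have hd : 0 < 2 * ‖V‖ + 1 := by positivity
  obtain ⟨p, hp⟩ := exists_polynomial_norm_sub_le hφ (div_pos hε hd)
  have h1 := norm_funOp_sub_aeval_le hT hσT hφ (div_pos hε hd).le hp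
  have h2 := norm_funOp_sub_aeval_le hS hσS hφ (div_pos hε hd).le hp
  have h3 : V * funOp φ T - funOp φ S * V =
      V * (funOp φ T - Polynomial.aeval T p) - (funOp φ S - Polynomial.aeval S p) * V := by
    rw [mul_sub, sub_mul, aeval_intertwine h]
    abel
  rw [h3, zero_add]
  calc _ ≤ ‖V‖ * ‖funOp φ T - Polynomial.aeval T p‖ +
        ‖funOp φ S - Polynomial.aeval S p‖ * ‖V‖ :=
        (norm_sub_le _ _).trans (add_le_add (norm_mul_le _ _) (norm_mul_le _ _))
    _ ≤ ‖V‖ * (ε / (2 * ‖V‖ + 1)) + ε / (2 * ‖V‖ + 1) * ‖V‖ := by gcongr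
    _ = ε * (2 * ‖V‖ / (2 * ‖V‖ + 1)) := by ring
    _ ≤ ε * 1 := by
      gcongr
      rw [div_le_one hd]
      linarith
    _ = ε := mul_one ε

/-- Neumann series: `‖γN‖ < 1`. The `+ 1` in the radius keeps it meaningful for `N = 0`. -/
theorem isUnit_one_add_smul {γ : ℂ} (hγ : ‖γ‖ < 1 / (‖N‖ + 1)) : IsUnit (1 + γ • N) := by
  have h : ‖-(γ • N)‖ < 1 := by
    rw [norm_neg, norm_smul]
    have h1 : 0 < ‖N‖ + 1 := by positivity
    rw [lt_div_iff₀ h1] at hγ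
    nlinarith [norm_nonneg γ, norm_nonneg N]
  simpa using isUnit_one_sub_of_norm_lt_one h

theorem spectrum_pert_eq (hNA : N * A - A * N = -B) (hNB : N * B = 0) {γ : ℂ}
    (hγ : ‖γ‖ < 1 / (‖N‖ + 1)) : spectrum ℂ (pert A B γ) = spectrum ℂ A := by
  obtain ⟨u, hu⟩ := isUnit_one_add_smul hγ
  have h := one_add_smul_mul_pert hNA hNB γ
  rw [← hu] at h
  rw [← spectrum.units_conjugate (a := pert A B γ) (u := u), h, mul_assoc, u.mul_inv, mul_one]

theorem funOp_pert_eq (hA : IsSelfAdjoint A) (hB : IsSelfAdjoint B)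
    (hNA : N * A - A * N = -B) (hNB : N * B = 0) {a b : ℝ}
    (hσ : spectrum ℂ A ⊆ (fun t : ℝ => (t : ℂ)) '' Set.Icc a b) {φ : ℝ → ℂ}
    (hφ : ContinuousOn φ (Set.Icc a b)) {γ : ℝ} (hγ : ‖(γ : ℂ)‖ < 1 / (‖N‖ + 1)) :
    funOp φ (pert A B (γ : ℂ)) =
      Ring.inverse (1 + (γ : ℂ) • N) * (funOp φ A * (1 + (γ : ℂ) • N)) := by
  have hσ' := (spectrum_pert_eq hNA hNB hγ).trans_subset hσ
  rw [← funOp_intertwine (pert_isSelfAdjoint hA hB γ) hA (one_add_smul_mul_pert hNA hNB γ)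
    hσ' hσ hφ, ← mul_assoc, Ring.inverse_mul_cancel _ (isUnit_one_add_smul hγ), one_mul]

/-- The conjugated operator is the extension: no functional calculus of the non-self-adjoint `A_γ`
is needed for complex `γ`, and the radius depends on `N` only, not on `φ`. -/
theorem hasFH_of_commutator (hA : IsSelfAdjoint A) (hB : IsSelfAdjoint B)
    (hNA : N * A - A * N = -B) (hNB : N * B = 0) {a b : ℝ}
    (hσ : spectrum ℂ A ⊆ (fun t : ℝ => (t : ℂ)) '' Set.Icc a b) : HasFH A B := by
  refine ⟨1 / (‖N‖ + 1), by positivity, fun φ hφ =>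
    ⟨fun γ => Ring.inverse (1 + γ • N) * (funOp φ A * (1 + γ • N)), ?_, fun γ hγ => ?_⟩⟩
  · intro γ hγ
    rw [mem_ball_zero_iff] at hγ
    have hd : DifferentiableAt ℂ (fun γ : ℂ => 1 + γ • N) γ := by fun_prop
    have hi : DifferentiableAt ℂ (fun γ : ℂ => Ring.inverse (1 + γ • N)) γ := by
      convert! (differentiableAt_inverse (𝕜 := ℂ) (isUnit_one_add_smul hγ)).comp γ hd
    exact (hi.mul (hd.const_mul _)).differentiableWithinAt
  · refine (funOp_pert_eq hA hB hNA hNB hσ hφ.continuousOn ?_).symm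
    rw [Complex.norm_real, Real.norm_eq_abs, abs_lt]
    exact hγ

theorem hasDerivAt_funOp_pert (hA : IsSelfAdjoint A) (hB : IsSelfAdjoint B)
    (hNA : N * A - A * N = -B) (hNB : N * B = 0) {a b : ℝ}
    (hσ : spectrum ℂ A ⊆ (fun t : ℝ => (t : ℂ)) '' Set.Icc a b) {φ : ℝ → ℂ}
    (hφ : ContinuousOn φ (Set.Icc a b)) :
    HasDerivAt (fun γ : ℝ => funOp φ (pert A B (γ : ℂ))) (funOp φ A * N - N * funOp φ A) 0 := by
  have hd : HasDerivAt (fun γ : ℝ => 1 + (γ : ℂ) • N) N 0 := by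
    have := ((hasDerivAt_id (0 : ℝ)).ofReal_comp.smul_const N).const_add 1
    simpa using this
  have hi : HasDerivAt (fun γ : ℝ => Ring.inverse (1 + (γ : ℂ) • N)) (-N) 0 := by
    -- Inversion has derivative `X ↦ -X` at the identity; the base point is written as `1 + 0 • N`
    -- to fit the chain rule.
    have h1 : HasFDerivAt Ring.inverse
        (-((ContinuousLinearMap.mulLeftRight ℝ (E →L[ℂ] E)) 1) 1)
        (1 + ((0 : ℝ) : ℂ) • N) := by
      simpa using hasFDerivAt_ringInverse (𝕜 := ℝ) (1 : (E →L[ℂ] E)ˣ)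
    simpa using! h1.comp_hasDerivAt 0 hd
  have h := hi.mul (hd.const_mul (funOp φ A))
  have h' : HasDerivAt
      (fun γ : ℝ => Ring.inverse (1 + (γ : ℂ) • N) * (funOp φ A * (1 + (γ : ℂ) • N)))
      (funOp φ A * N - N * funOp φ A) 0 := by
    refine h.congr_deriv ?_
    simp [Ring.inverse_one]
    abel
  refine h'.congr_of_eventuallyEq ?_
  filter_upwards [eventually_norm_ofReal_lt N] with γ hγ
  exact funOp_pert_eq hA hB hNA hNB hσ hφ hγ

end Abstract

/-! ### The Fourier transform on `L¹ ∩ L²` -/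

/-- Smooth compactly supported functions are Schwartz, and they separate locally integrable
functions. This identifies `L²` Fourier transforms, known through distributions, with pointwise
integrals. -/
theorem coeFn_eq_of_toTemperedDistribution {F : Lp ℂ 2 (volume : Measure ℝ)} {G : ℝ → ℂ}
    (hG : Continuous G)
    (h : ∀ u : SchwartzMap ℝ ℂ, Lp.toTemperedDistribution F u = ∫ x, u x * G x) :
    F =ᵐ[volume] G := by
  refine ae_eq_of_integral_contDiff_smul_eq ((Lp.memLp F).locallyIntegrable one_le_two)
    hG.locallyIntegrable fun u hu hc => ?_
  have hg₁ : HasCompactSupport (Complex.ofRealCLM ∘ u) := hc.comp_left rfl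
  have hg₂ : ContDiff ℝ (⊤ : ℕ∞) (Complex.ofRealCLM ∘ u) := by fun_prop
  simpa [Lp.toTemperedDistribution_apply] using h (hg₁.toSchwartzMap hg₂)

theorem continuous_fourier_of_integrable {w : ℝ → ℂ} (hw : Integrable w) : Continuous (𝓕 w) :=
  VectorFourier.fourierIntegral_continuous Real.continuous_fourierChar continuous_inner hw

theorem continuous_fourierInv_of_integrable {w : ℝ → ℂ} (hw : Integrable w) :
    Continuous (𝓕⁻ w) :=
  VectorFourier.fourierIntegral_continuous (L := -innerₗ ℝ) Real.continuous_fourierChar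
    continuous_inner.neg hw

theorem integral_fourier_mul_eq {u v : ℝ → ℂ} (hu : Integrable u) (hv : Integrable v) :
    ∫ x, 𝓕 u x * v x = ∫ x, u x * 𝓕 v x := by
  simpa using! VectorFourier.integral_fourierIntegral_smul_eq_flip (L := innerₗ ℝ)
    Real.continuous_fourierChar continuous_inner hu hv

theorem integral_fourierInv_mul_eq {u v : ℝ → ℂ} (hu : Integrable u) (hv : Integrable v) :
    ∫ x, 𝓕⁻ u x * v x = ∫ x, u x * 𝓕⁻ v x := by
  have hflip : (-innerₗ ℝ).flip = -innerₗ ℝ := by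
    ext
    simp
  have h := VectorFourier.integral_fourierIntegral_smul_eq_flip (L := -innerₗ ℝ)
    Real.continuous_fourierChar continuous_inner.neg hu hv
  rw [hflip] at h
  exact h

/-- On `L¹ ∩ L²` the `L²` Fourier transform is given by the Fourier integral. -/
theorem coeFn_fourier_toLp {w : ℝ → ℂ} (hw : Integrable w) (hw2 : MemLp w 2) :
    (𝓕 (hw2.toLp w) : Lp ℂ 2 (volume : Measure ℝ)) =ᵐ[volume] 𝓕 w := by
  refine coeFn_eq_of_toTemperedDistribution (continuous_fourier_of_integrable hw) fun u => ?_
  rw [← Lp.fourier_toTemperedDistribution_eq, TemperedDistribution.fourier_apply,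
    Lp.toTemperedDistribution_apply, ← integral_fourier_mul_eq u.integrable hw]
  refine integral_congr_ae ?_
  filter_upwards [hw2.coeFn_toLp] with x hx
  rw [hx, SchwartzMap.fourier_coe, smul_eq_mul]

theorem coeFn_fourierInv_toLp {w : ℝ → ℂ} (hw : Integrable w) (hw2 : MemLp w 2) :
    (𝓕⁻ (hw2.toLp w) : Lp ℂ 2 (volume : Measure ℝ)) =ᵐ[volume] 𝓕⁻ w := by
  refine coeFn_eq_of_toTemperedDistribution (continuous_fourierInv_of_integrable hw) fun u => ?_
  rw [← Lp.fourierInv_toTemperedDistribution_eq, TemperedDistribution.fourierInv_apply,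
    Lp.toTemperedDistribution_apply, ← integral_fourierInv_mul_eq u.integrable hw]
  refine integral_congr_ae ?_
  filter_upwards [hw2.coeFn_toLp] with x hx
  rw [hx, SchwartzMap.fourierInv_coe, smul_eq_mul]

/-! ### The Riesz projection as a limit of Cauchy integrals -/

/-- The function `exp (-2 π ε ω)` cut off to the half-line `ω > 0`. -/
noncomputable def expCutoff (ε : ℝ) : ℝ → ℂ :=
  (Set.Ioi 0).indicator fun ω => ((Real.exp (-(2 * Real.pi * ε * ω)) : ℝ) : ℂ)

theorem measurable_expCutoff (ε : ℝ) : Measurable (expCutoff ε) :=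
  Measurable.indicator (by fun_prop) measurableSet_Ioi

theorem norm_expCutoff_le {ε : ℝ} (hε : 0 ≤ ε) (ω : ℝ) : ‖expCutoff ε ω‖ ≤ 1 := by
  rw [expCutoff, Set.indicator_apply]
  split_ifs with h
  · rw [Complex.norm_real, Real.norm_eq_abs, Real.abs_exp, Real.exp_le_one_iff]
    have : (0 : ℝ) < ω := h
    have := Real.pi_pos
    rw [neg_nonpos]
    positivity
  · simp

theorem integrable_expCutoff {ε : ℝ} (hε : 0 < ε) : Integrable (expCutoff ε) := by
  rw [expCutoff, integrable_indicator_iff measurableSet_Ioi]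
  have h : 0 < 2 * Real.pi * ε := by positivity
  simpa only [neg_mul, IntegrableOn] using! (exp_neg_integrableOn_Ioi 0 h).ofReal (𝕜 := ℂ)

theorem tendsto_expCutoff (ω : ℝ) : Tendsto (fun ε => expCutoff ε ω) (𝓝 0) (𝓝 (expCutoff 0 ω)) := by
  have : Continuous fun ε => expCutoff ε ω := by
    simp only [expCutoff, Set.indicator_apply]
    split_ifs <;> fun_prop
  exact this.tendsto 0

theorem IsMulOp.coeFn {μ ν : Measure ℝ} {h : ℝ → ℂ} {T : Lp ℂ 2 μ →L[ℂ] Lp ℂ 2 ν}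
    (hT : IsMulOp μ ν h T) (f : Lp ℂ 2 μ) : T f =ᵐ[ν] fun x => h x * f x := by
  have := hT f (Lp.memLp f)
  rwa [Lp.toLp_coeFn] at this

theorem isMulOp_expCutoff {ε : ℝ} (hε : 0 ≤ ε) :
    IsMulOp volume volume (expCutoff ε) (mulOp volume volume (expCutoff ε)) :=
  isMulOp_mulOp (measurable_expCutoff ε).aestronglyMeasurable 1
    (ae_of_all _ fun ω => norm_expCutoff_le hε ω)

/-- By Plancherel the projection is a sharp cutoff in frequency: `expCutoff 0` is the indicator of
the open half-line, and the point `ω = 0` is null. -/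
theorem rieszProj_eq (f : Lp ℂ 2 (volume : Measure ℝ)) :
    rieszProj f = 𝓕⁻ (mulOp volume volume (expCutoff 0) (𝓕 f)) := by
  have hm := (isMulOp_expCutoff le_rfl).coeFn (𝓕 f)
  have h0 : ∀ ω : ℝ, expCutoff 0 ω = if 0 < ω then 1 else 0 := fun ω => by
    simp [expCutoff, Set.indicator_apply]
  refine Submodule.eq_starProjection_of_mem_orthogonal ?_ ?_
  · change ∀ᵐ ω : ℝ, ω < 0 → (𝓕 (𝓕⁻ _ : Lp ℂ 2 (volume : Measure ℝ)) : Lp ℂ 2 volume) ω = 0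
    rw [FourierTransform.fourier_fourierInv_eq (E := Lp ℂ 2 (volume : Measure ℝ))
      (F := Lp ℂ 2 (volume : Measure ℝ))]
    filter_upwards [hm] with ω hω hneg
    rw [hω, h0, if_neg hneg.le.not_gt, zero_mul]
  · rw [Submodule.mem_orthogonal]
    intro u hu
    have hu' : ∀ᵐ ω : ℝ, ω < 0 → (𝓕 u : Lp ℂ 2 (volume : Measure ℝ)) ω = 0 := hu
    have hsub : 𝓕 (f - 𝓕⁻ (mulOp volume volume (expCutoff 0) (𝓕 f))) =
        𝓕 f - mulOp volume volume (expCutoff 0) (𝓕 f) := by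
      conv_rhs => rw [← FourierTransform.fourier_fourierInv_eq (E := Lp ℂ 2 (volume : Measure ℝ))
        (F := Lp ℂ 2 (volume : Measure ℝ)) (mulOp volume volume (expCutoff 0) (𝓕 f))]
      exact (Lp.fourierTransformₗᵢ ℝ ℂ).map_sub _ _
    rw [← Lp.inner_fourier_eq, hsub, L2.inner_def]
    refine integral_eq_zero_of_ae ?_
    have hne : ∀ᵐ ω : ℝ, ω ≠ 0 := by simp [ae_iff, measure_singleton]
    filter_upwards [hm, hu', Lp.coeFn_sub (𝓕 f) (mulOp volume volume (expCutoff 0) (𝓕 f)), hne]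
      with ω h1 h2 h3 h4
    rw [h3, Pi.sub_apply, h1, h0]
    rcases lt_or_gt_of_ne h4 with h | h
    · simp [h2 h]
    · simp [h]

/-- Dominated convergence for the squared norms, with majorant `4‖F‖²`. The convergence is strong,
which suffices. -/
theorem tendsto_mulOp_expCutoff (F : Lp ℂ 2 (volume : Measure ℝ)) {ε : ℕ → ℝ}
    (hε : ∀ n, 0 < ε n) (hlim : Tendsto ε atTop (𝓝 0)) :
    Tendsto (fun n => mulOp volume volume (expCutoff (ε n)) F) atTop
      (𝓝 (mulOp volume volume (expCutoff 0) F)) := by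
  rw [tendsto_iff_norm_sub_tendsto_zero]
  set D : ℕ → Lp ℂ 2 (volume : Measure ℝ) := fun n =>
    mulOp volume volume (expCutoff (ε n)) F - mulOp volume volume (expCutoff 0) F
  have hD : ∀ n, D n =ᵐ[volume] fun ω => (expCutoff (ε n) ω - expCutoff 0 ω) * F ω := fun n => by
    filter_upwards [Lp.coeFn_sub (mulOp volume volume (expCutoff (ε n)) F)
      (mulOp volume volume (expCutoff 0) F), (isMulOp_expCutoff (hε n).le).coeFn F,
      (isMulOp_expCutoff le_rfl).coeFn F] with ω h1 h2 h3
    rw [h1, Pi.sub_apply, h2, h3, sub_mul]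
  have hF : Integrable fun ω => ‖F ω‖ ^ 2 := (Lp.memLp F).integrable_norm_pow two_ne_zero
  have hsq : Tendsto (fun n => ∫ ω, ‖D n ω‖ ^ 2) atTop (𝓝 0) := by
    have := tendsto_integral_of_dominated_convergence (F := fun n ω => ‖D n ω‖ ^ 2)
      (f := fun _ => (0 : ℝ)) (μ := (volume : Measure ℝ)) (fun ω => 4 * ‖F ω‖ ^ 2)
      (fun n => (Lp.aestronglyMeasurable (D n)).norm.pow 2) (hF.const_mul 4) (fun n => ?_) ?_
    · simpa using this
    · filter_upwards [hD n] with ω hω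
      have h2 : ‖expCutoff (ε n) ω - expCutoff 0 ω‖ ≤ 2 :=
        (norm_sub_le _ _).trans (by
          linarith [norm_expCutoff_le (hε n).le ω, norm_expCutoff_le le_rfl ω])
      rw [hω, norm_mul, mul_pow, Real.norm_eq_abs, abs_of_nonneg (by positivity)]
      gcongr
      calc _ ≤ (2 : ℝ) ^ 2 := by gcongr
        _ = 4 := by norm_num
    · filter_upwards [ae_all_iff.mpr hD] with ω hω
      simp_rw [hω]
      have h1 := ((tendsto_expCutoff ω).comp hlim).sub_const (expCutoff 0 ω)
      simpa using ((h1.mul_const (F ω)).norm.pow 2)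
  have hnorm : ∀ n, ‖D n‖ ^ 2 = ∫ ω, ‖D n ω‖ ^ 2 := fun n => by
    have h : ((‖D n‖ : ℂ)) ^ 2 = ∫ ω, ((‖D n ω‖ ^ 2 : ℝ) : ℂ) := by
      refine (inner_self_eq_norm_sq_to_K (𝕜 := ℂ) (D n)).symm.trans ?_
      rw [L2.inner_def]
      congr 1 with ω
      rw [inner_self_eq_norm_sq_to_K]
      push_cast
      rfl
    rw [integral_complex_ofReal] at h
    exact_mod_cast h
  simp_rw [← hnorm] at hsq
  simpa using hsq.sqrt

/-- The damped half-line exponential integrates to the Cauchy kernel at `x + iε`; this links the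
frequency cutoff to Cauchy integrals. -/
theorem fourier_expCutoff_mul {ε : ℝ} (hε : 0 < ε) (x t : ℝ) :
    𝓕 (fun ω : ℝ => Complex.exp ((2 * Real.pi * x * ω : ℝ) * Complex.I) * expCutoff ε ω) t =
      (2 * Real.pi * Complex.I)⁻¹ * ((t : ℂ) - (x + ε * Complex.I))⁻¹ := by
  set a : ℂ := 2 * Real.pi * Complex.I * (x + ε * Complex.I - t) with ha
  have hre : a.re < 0 := by
    have : a.re = -(2 * Real.pi * ε) := by simp [ha]
    rw [this, neg_lt_zero]
    positivity
  have hint : 𝓕 (fun ω : ℝ =>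
      Complex.exp ((2 * Real.pi * x * ω : ℝ) * Complex.I) * expCutoff ε ω) t =
      ∫ ω in Set.Ioi (0 : ℝ), Complex.exp (a * ω) := by
    rw [Real.fourier_eq', ← integral_indicator measurableSet_Ioi]
    congr 1 with ω
    rw [expCutoff, Set.indicator_apply, Set.indicator_apply]
    split_ifs with h
    · rw [Complex.ofReal_exp, smul_eq_mul, ← Complex.exp_add, ← Complex.exp_add]
      congr 1
      rw [ha]
      simp only [RCLike.inner_apply, conj_trivial]
      push_cast
      linear_combination (2 * Real.pi * ε * ω : ℂ) * (-Complex.I_sq)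
    · simp
  rw [hint, integral_exp_mul_complex_Ioi hre]
  have hz : (x : ℂ) + ε * Complex.I - t = -((t : ℂ) - (x + ε * Complex.I)) := by ring
  rw [ha, hz, Complex.ofReal_zero, mul_zero, Complex.exp_zero, mul_neg, neg_div_neg_eq, one_div,
    mul_inv]

/-- The Cauchy integrals of `w ∈ L¹ ∩ L²`, on the Fourier side. -/
theorem coeFn_fourierInv_expCutoff {w : ℝ → ℂ} (hw : Integrable w) (hw2 : MemLp w 2) {ε : ℝ}
    (hε : 0 < ε) :
    ∀ᵐ x : ℝ, 2 * Real.pi * Complex.I *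
      (𝓕⁻ (mulOp volume volume (expCutoff ε) (𝓕 (hw2.toLp w))) : Lp ℂ 2 (volume : Measure ℝ)) x =
        ∫ t : ℝ, w t * ((t : ℂ) - (x + ε * Complex.I))⁻¹ := by
  set F := mulOp volume volume (expCutoff ε) (𝓕 (hw2.toLp w)) with hF
  have hFae : F =ᵐ[volume] fun ω => expCutoff ε ω * 𝓕 w ω := by
    filter_upwards [(isMulOp_expCutoff hε.le).coeFn (𝓕 (hw2.toLp w)), coeFn_fourier_toLp hw hw2]
      with ω h1 h2
    rw [h1, h2]
  have hmem : MemLp (fun ω => expCutoff ε ω * 𝓕 w ω) 2 :=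
    (memLp_congr_ae hFae).mp (Lp.memLp F)
  -- The transform of an `L¹` function is bounded, so the damping makes the product integrable and
  -- its inverse transform a genuine integral.
  have hint : Integrable (fun ω => expCutoff ε ω * 𝓕 w ω) := by
    refine (integrable_expCutoff hε).mul_bdd (c := ∫ t, ‖w t‖)
      (continuous_fourier_of_integrable hw).aestronglyMeasurable (ae_of_all _ fun ω => ?_)
    exact VectorFourier.norm_fourierIntegral_le_integral_norm _ _ _ _ _
  have hFeq : F = hmem.toLp _ := Lp.ext (hFae.trans hmem.coeFn_toLp.symm)
  rw [hFeq]
  filter_upwards [coeFn_fourierInv_toLp hint hmem] with x hx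
  have hh : Integrable fun ω : ℝ =>
      Complex.exp ((2 * Real.pi * x * ω : ℝ) * Complex.I) * expCutoff ε ω := by
    refine (integrable_expCutoff hε).bdd_mul (c := 1)
      (by fun_prop) (ae_of_all _ fun ω => (Complex.norm_exp_ofReal_mul_I _).le)
  have h1 : 𝓕⁻ (fun ω => expCutoff ε ω * 𝓕 w ω) x = ∫ ω : ℝ, 𝓕 w ω *
      (Complex.exp ((2 * Real.pi * x * ω : ℝ) * Complex.I) * expCutoff ε ω) := by
    rw [Real.fourierInv_eq']
    congr 1 with ω
    simp only [RCLike.inner_apply, conj_trivial, smul_eq_mul]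
    push_cast
    ring_nf
  -- The transform is moved from `w` onto the kernel.
  rw [hx, h1, integral_fourier_mul_eq hw hh, ← integral_const_mul]
  congr 1 with t
  rw [fourier_expCutoff_mul hε]
  have : (2 * Real.pi * Complex.I : ℂ) ≠ 0 := Complex.two_pi_I_ne_zero
  field_simp

/-- Sokhotski's formula: the Cauchy integrals of `w ∈ L¹ ∩ L²` converge from above to
`2 π i P₊ w`, almost everywhere along a subsequence. -/
theorem exists_subseq_tendsto_cauchy {w : ℝ → ℂ} (hw : Integrable w) (hw2 : MemLp w 2)
    {ε : ℕ → ℝ} (hε : ∀ n, 0 < ε n) (hlim : Tendsto ε atTop (𝓝 0)) :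
    ∃ ns : ℕ → ℕ, StrictMono ns ∧ ∀ᵐ x : ℝ,
      Tendsto (fun n => ∫ t : ℝ, w t * ((t : ℂ) - (x + ε (ns n) * Complex.I))⁻¹) atTop
        (𝓝 (2 * Real.pi * Complex.I * rieszProj (hw2.toLp w) x)) := by
  have h1 : Tendsto (fun n => 𝓕⁻ (mulOp volume volume (expCutoff (ε n)) (𝓕 (hw2.toLp w))))
      atTop (𝓝 (rieszProj (hw2.toLp w))) := by
    rw [rieszProj_eq]
    exact ((Lp.fourierTransformₗᵢ ℝ ℂ).symm.continuous.tendsto _).comp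
      (tendsto_mulOp_expCutoff _ hε hlim)
  obtain ⟨ns, hns, h2⟩ := (tendstoInMeasure_of_tendsto_Lp h1).exists_seq_tendsto_ae
  refine ⟨ns, hns, ?_⟩
  filter_upwards [h2, ae_all_iff.mpr fun n => coeFn_fourierInv_expCutoff hw hw2 (hε n)]
    with x hx h3
  simp_rw [← h3]
  exact hx.const_mul _

/-! ### Bounded Borel transform and bounded density -/

theorem integrable_mul_inv_sub {ρ : Measure ℝ} {f : ℝ → ℂ} (hf : Integrable f ρ) {z : ℂ} (hz : 0 < z.im) :
    Integrable (fun t : ℝ => f t * ((t : ℂ) - z)⁻¹) ρ := by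
  refine hf.mul_bdd (c := z.im⁻¹) (Measurable.aestronglyMeasurable (by fun_prop))
    (ae_of_all _ fun t => ?_)
  rw [norm_inv]
  gcongr
  have := Complex.abs_im_le_norm ((t : ℂ) - z)
  simpa [abs_of_pos hz] using this

theorem integrable_inv_sub {ρ : Measure ℝ} [IsFiniteMeasure ρ] {z : ℂ} (hz : 0 < z.im) :
    Integrable (fun t : ℝ => ((t : ℂ) - z)⁻¹) ρ := by
  simpa using integrable_mul_inv_sub (integrable_const (1 : ℂ)) hz

/-- The imaginary part is the integral of the kernel `r / ((t - c)² + r²)`, which is positive and at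
least `1 / (2r)` within distance `r` of `c`. -/
theorem borelTransform_im_ge {ρ : Measure ℝ} [IsFiniteMeasure ρ] (c : ℝ) {r : ℝ} (hr : 0 < r) :
    ρ.real (Set.Icc (c - r) (c + r)) * (2 * r)⁻¹ ≤ (borelTransform ρ (c + r * Complex.I)).im := by
  have hz : 0 < ((c : ℂ) + r * Complex.I).im := by simpa using hr
  have him : ∀ t : ℝ, ((t : ℂ) - (c + r * Complex.I))⁻¹.im = r / ((t - c) ^ 2 + r ^ 2) :=
    fun t => by
      rw [Complex.inv_im, Complex.normSq_apply]
      simp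
      ring
  have h1 : (borelTransform ρ (c + r * Complex.I)).im =
      ∫ t, r / ((t - c) ^ 2 + r ^ 2) ∂ρ := by
    simp_rw [← him]
    exact (integral_im (𝕜 := ℂ) (integrable_inv_sub hz)).symm
  have hi : Integrable (fun t : ℝ => r / ((t - c) ^ 2 + r ^ 2)) ρ := by
    simp_rw [← him]
    exact (integrable_inv_sub hz).im
  rw [h1, ← smul_eq_mul, ← setIntegral_const]
  refine (setIntegral_mono_on (integrable_const _).integrableOn hi.integrableOn measurableSet_Icc fun t ht => ?_).trans
    (setIntegral_le_integral hi (ae_of_all _ fun t => by positivity))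
  have h2 : (t - c) ^ 2 ≤ r ^ 2 := sq_le_sq' (by linarith [ht.1]) (by linarith [ht.2])
  rw [inv_eq_one_div, div_le_div_iff₀ (by positivity) (by positivity)]
  nlinarith

/-- A measure dominated by Lebesgue measure on compact intervals is dominated on all sets. -/
theorem le_smul_volume_of_Icc {ρ : Measure ℝ} {C : ℝ≥0} (hC : C ≠ 0)
    (h : ∀ a b, a < b → ρ (Set.Icc a b) ≤ C * ENNReal.ofReal (b - a)) :
    ρ ≤ (C : ℝ≥0∞) • (volume : Measure ℝ) := by
  have hC0 : (C : ℝ≥0∞) ≠ 0 := ENNReal.coe_ne_zero.mpr hC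
  -- Lebesgue outer measure is the largest outer measure dominated by interval length, so it is
  -- enough to compare with lengths.
  have key : ((C : ℝ≥0∞)⁻¹ • ρ).toOuterMeasure ≤
      OuterMeasure.ofFunction StieltjesFunction.id.length StieltjesFunction.id.length_empty := by
    refine OuterMeasure.le_ofFunction.mpr fun s => ?_
    rw [StieltjesFunction.length_eq]
    refine le_iInf fun a => le_iInf fun b => le_iInf fun hs => ?_
    -- The general length formula discards a least element; `ℝ` has none.
    have hs' : s ⊆ Set.Ioc a b := fun x hx =>
      hs ⟨hx, notMem_botSet_of_lt (sub_one_lt x)⟩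
    change (C : ℝ≥0∞)⁻¹ * ρ s ≤ _
    rcases lt_or_ge a b with hab | hab
    · calc (C : ℝ≥0∞)⁻¹ * ρ s ≤ (C : ℝ≥0∞)⁻¹ * (C * ENNReal.ofReal (b - a)) := by
            gcongr
            exact (measure_mono (hs'.trans Set.Ioc_subset_Icc_self)).trans (h a b hab)
        _ = ENNReal.ofReal (b - a) := by
            rw [← mul_assoc, ENNReal.inv_mul_cancel hC0 ENNReal.coe_ne_top, one_mul]
    · rw [Set.Ioc_eq_empty hab.not_gt, Set.subset_empty_iff] at hs'
      simp [hs']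
  refine Measure.le_iff'.mpr fun s => ?_
  have hs : (C : ℝ≥0∞)⁻¹ * ρ s ≤ volume s := by
    rw [Real.volume_eq_stieltjes_id, StieltjesFunction.measure]
    exact key s
  calc ρ s = C * ((C : ℝ≥0∞)⁻¹ * ρ s) := by
        rw [← mul_assoc, ENNReal.mul_inv_cancel hC0 ENNReal.coe_ne_top, one_mul]
    _ ≤ C * volume s := by gcongr

theorem hasBoundedDensity_of_le {ρ : Measure ℝ} {C : ℝ≥0} (hC : C ≠ 0) [IsFiniteMeasure ρ]
    (h : ρ ≤ (C : ℝ≥0∞) • (volume : Measure ℝ)) : HasBoundedDensity ρ := by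
  have hac : ρ ≪ volume :=
    (Measure.absolutelyContinuous_of_le h).trans Measure.smul_absolutelyContinuous
  refine ⟨hac, C, ?_⟩
  have : SigmaFinite ((C : ℝ≥0∞) • (volume : Measure ℝ)) :=
    inferInstanceAs (SigmaFinite (C • (volume : Measure ℝ)))
  have h1 := Measure.rnDeriv_le_one_of_le h
  have h2 := Measure.rnDeriv_smul_right_of_ne_top ρ volume (ENNReal.coe_ne_zero.mpr hC)
    ENNReal.coe_ne_top
  have h3 := (Measure.absolutelyContinuous_smul (μ := (volume : Measure ℝ))
    (ENNReal.coe_ne_zero.mpr hC))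
  filter_upwards [h3.ae_le h1, h2] with x hx1 hx2
  rw [hx2, Pi.smul_apply, smul_eq_mul, Pi.one_apply] at hx1
  have hx : ρ.rnDeriv volume x ≤ C := by
    calc _ = C * ((C : ℝ≥0∞)⁻¹ * ρ.rnDeriv volume x) := by
          rw [← mul_assoc, ENNReal.mul_inv_cancel (ENNReal.coe_ne_zero.mpr hC)
            ENNReal.coe_ne_top, one_mul]
      _ ≤ C * 1 := by gcongr
      _ = C := mul_one _
  exact ENNReal.toReal_le_coe_of_le_coe hx

/-- Evaluating the Borel transform above the midpoint of `[a, b]`, at height half its length, gives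
`ρ[a, b] ≤ C(b - a)`. The constant `C + 1` is used to have it nonzero. -/
theorem HasBTB.hasBoundedDensity {ρ : Measure ℝ} [IsFiniteMeasure ρ] (h : HasBTB ρ) :
    HasBoundedDensity ρ := by
  obtain ⟨C, hC⟩ := h
  have hC0 : 0 ≤ C := (norm_nonneg _).trans (hC Complex.I (by simp))
  have hC1 : C.toNNReal + 1 ≠ 0 := by positivity
  refine hasBoundedDensity_of_le hC1 (le_smul_volume_of_Icc hC1 fun a b hab => ?_)
  have hr : 0 < (b - a) / 2 := by linarith
  have h1 := borelTransform_im_ge (ρ := ρ) ((a + b) / 2) hr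
  have h2 := (Complex.abs_im_le_norm _).trans
    (hC (((a + b) / 2 : ℝ) + ((b - a) / 2 : ℝ) * Complex.I) (by simpa using hr))
  rw [show (a + b) / 2 - (b - a) / 2 = a by ring, show (a + b) / 2 + (b - a) / 2 = b by ring,
    ← div_eq_mul_inv, div_le_iff₀ (by linarith)] at h1
  have h3 : ρ.real (Set.Icc a b) ≤ (C + 1) * (b - a) := by
    nlinarith [le_abs_self (borelTransform ρ
      (((a + b) / 2 : ℝ) + ((b - a) / 2 : ℝ) * Complex.I)).im]
  rw [← ofReal_measureReal]
  refine (ENNReal.ofReal_le_ofReal h3).trans_eq ?_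
  rw [ENNReal.ofReal_mul (by positivity), ENNReal.ofReal_add hC0 zero_le_one, ENNReal.coe_add]
  simp [ENNReal.ofReal]

/-! ### Functions of the operator of multiplication by the independent variable -/

theorem isMulOp_of_continuousOn {ρ : Measure ℝ} {M : ℝ} (hM : ρ.support ⊆ Set.Icc (-M) M)
    {φ : ℝ → ℂ} (hφ : ContinuousOn φ (Set.Icc (-M) M)) : IsMulOp ρ ρ φ (mulOp ρ ρ φ) := by
  obtain ⟨C, hC⟩ := isCompact_Icc.exists_bound_of_continuousOn hφ
  have hsupp : ∀ᵐ x ∂ρ, x ∈ Set.Icc (-M) M := by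
    filter_upwards [Measure.support_mem_ae (μ := ρ)] with x hx using hM hx
  refine isMulOp_mulOp ?_ C.toNNReal ?_
  · have h := hφ.aestronglyMeasurable (μ := ρ) measurableSet_Icc
    rwa [Measure.restrict_eq_self_of_ae_mem hsupp] at h
  · filter_upwards [hsupp] with x hx
    rw [← NNReal.coe_le_coe]
    exact (hC x hx).trans (Real.le_coe_toNNReal C)

/-- Off the support the resolvent is multiplication by `1/(z - t)`, bounded by compactness. -/
theorem spectrum_posOp_subset {ρ : Measure ℝ} (hρ : IsCompact ρ.support) :
    spectrum ℂ (posOp ρ) ⊆ (fun t : ℝ => (t : ℂ)) '' ρ.support := by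
  intro z hz
  by_contra hzn
  refine hz ?_
  have hne : ∀ t ∈ ρ.support, z - (t : ℂ) ≠ 0 := fun t ht h0 =>
    hzn ⟨t, ht, (sub_eq_zero.mp h0).symm⟩
  have hcont : ContinuousOn (fun t : ℝ => (z - (t : ℂ))⁻¹) ρ.support :=
    ContinuousOn.inv₀ (by fun_prop) hne
  obtain ⟨C, hC⟩ := hρ.exists_bound_of_continuousOn hcont
  have hmul : IsMulOp ρ ρ (fun t : ℝ => (z - (t : ℂ))⁻¹) (mulOp ρ ρ fun t : ℝ => (z - (t : ℂ))⁻¹) :=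
    isMulOp_mulOp (Measurable.aestronglyMeasurable (by fun_prop)) C.toNNReal (by
      filter_upwards [Measure.support_mem_ae (μ := ρ)] with t ht
      rw [← NNReal.coe_le_coe]
      exact (hC t ht).trans (Real.le_coe_toNNReal C))
  have hsub : ∀ f : Lp ℂ 2 ρ, (algebraMap ℂ (Lp ℂ 2 ρ →L[ℂ] Lp ℂ 2 ρ) z - posOp ρ) f =ᵐ[ρ]
      fun t => (z - (t : ℂ)) * f t := fun f => by
    rw [sub_apply, ContinuousLinearMap.algebraMap_apply]
    filter_upwards [Lp.coeFn_sub (z • f) (posOp ρ f), Lp.coeFn_smul z f,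
      (isMulOp_posOp hρ).coeFn f] with t h1 h2 h3
    rw [h1, Pi.sub_apply, h2, h3, Pi.smul_apply, smul_eq_mul, sub_mul]
  refine isUnit_iff_exists.mpr ⟨mulOp ρ ρ fun t : ℝ => (z - (t : ℂ))⁻¹, ?_, ?_⟩
  · ext1 f
    refine Lp.ext ?_
    filter_upwards [hsub (mulOp ρ ρ (fun t : ℝ => (z - (t : ℂ))⁻¹) f), hmul.coeFn f,
      Measure.support_mem_ae (μ := ρ)] with t h1 h2 ht
    rw [mul_apply_eq_comp, h1, h2, mul_inv_cancel_left₀ (hne t ht),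
      one_apply_eq_self]
  · ext1 f
    refine Lp.ext ?_
    filter_upwards [hsub f, hmul.coeFn ((algebraMap ℂ (Lp ℂ 2 ρ →L[ℂ] Lp ℂ 2 ρ) z - posOp ρ) f),
      Measure.support_mem_ae (μ := ρ)] with t h1 h2 ht
    rw [mul_apply_eq_comp, h2, h1, inv_mul_cancel_left₀ (hne t ht),
      one_apply_eq_self]

theorem isMulOp_aeval_posOp {ρ : Measure ℝ} (hρ : IsCompact ρ.support) (p : Polynomial ℂ) :
    IsMulOp ρ ρ (fun t : ℝ => p.eval (t : ℂ)) (Polynomial.aeval (posOp ρ) p) := by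
  suffices h : ∀ f : Lp ℂ 2 ρ, Polynomial.aeval (posOp ρ) p f =ᵐ[ρ]
      fun t => p.eval (t : ℂ) * f t by
    intro f hf
    filter_upwards [h (hf.toLp f), hf.coeFn_toLp] with t h1 h2
    rw [h1, h2]
  induction p using Polynomial.induction_on' with
  | add p q hp hq =>
    intro f
    rw [map_add, add_apply]
    filter_upwards [Lp.coeFn_add (Polynomial.aeval (posOp ρ) p f) (Polynomial.aeval (posOp ρ) q f),
      hp f, hq f] with t h1 h2 h3
    rw [h1, Pi.add_apply, h2, h3, Polynomial.eval_add, add_mul]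
  | monomial n c =>
    have hpow : ∀ f : Lp ℂ 2 ρ, (posOp ρ ^ n) f =ᵐ[ρ] fun t => (t : ℂ) ^ n * f t := by
      induction n with
      | zero => intro f; simp
      | succ n ih =>
        intro f
        rw [pow_succ, mul_apply_eq_comp]
        filter_upwards [ih (posOp ρ f), (isMulOp_posOp hρ).coeFn f] with t h1 h2
        rw [h1, h2]
        ring
    intro f
    rw [Polynomial.aeval_monomial, ← Algebra.smul_def, smul_apply]
    filter_upwards [Lp.coeFn_smul c ((posOp ρ ^ n) f), hpow f] with t h1 h2
    rw [h1, Pi.smul_apply, h2, Polynomial.eval_monomial, smul_eq_mul, mul_assoc]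

/-- Functions of the multiplication operator `A` are multiplication operators. -/
theorem isMulOp_funOp_posOp {ρ : Measure ℝ} (hρ : IsCompact ρ.support) {M : ℝ}
    (hM : ρ.support ⊆ Set.Icc (-M) M) {φ : ℝ → ℂ} (hφ : ContinuousOn φ (Set.Icc (-M) M)) :
    IsMulOp ρ ρ φ (funOp φ (posOp ρ)) := by
  have hmul := isMulOp_of_continuousOn hM hφ
  suffices h : funOp φ (posOp ρ) = mulOp ρ ρ φ by rwa [h]
  rw [← sub_eq_zero, ← norm_le_zero_iff]
  refine le_of_forall_pos_le_add fun ε hε => ?_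
  obtain ⟨p, hp⟩ := exists_polynomial_norm_sub_le hφ (half_pos hε)
  have h1 := norm_funOp_sub_aeval_le (isSelfAdjoint_posOp hρ)
    ((spectrum_posOp_subset hρ).trans (Set.image_mono hM)) hφ (half_pos hε).le hp
  have h2 : ‖Polynomial.aeval (posOp ρ) p - mulOp ρ ρ φ‖ ≤ ε / 2 := by
    refine ContinuousLinearMap.opNorm_le_bound _ (half_pos hε).le fun f => ?_
    refine Lp.norm_le_mul_norm_of_ae_le_mul ?_
    rw [sub_apply]
    filter_upwards [Lp.coeFn_sub (Polynomial.aeval (posOp ρ) p f) (mulOp ρ ρ φ f),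
      (isMulOp_aeval_posOp hρ p).coeFn f, hmul.coeFn f, Measure.support_mem_ae (μ := ρ)]
      with t h1 h2 h3 ht
    rw [h1, Pi.sub_apply, h2, h3, ← sub_mul, norm_mul]
    gcongr
    exact hp t (hM ht)
  rw [← sub_add_sub_cancel _ (Polynomial.aeval (posOp ρ) p)]
  exact (norm_add_le _ _).trans (by linarith)

/-! ### The Cauchy operator on `L²(ρ)` -/

section Cauchy

variable {ρ : Measure ℝ} [IsFiniteMeasure ρ]

/-- A `ρ`-null set may have positive Lebesgue measure, but only where the density vanishes; there
the factor `ρ̃` kills whatever is undetermined. -/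
theorem HasBoundedDensity.ae_of_ae (hd : HasBoundedDensity ρ) {P : ℝ → Prop}
    (h : ∀ᵐ x ∂ρ, P x) : ∀ᵐ x : ℝ, density ρ x ≠ 0 → P x := by
  rw [← Measure.withDensity_rnDeriv_eq ρ volume hd.1,
    ae_withDensity_iff (Measure.measurable_rnDeriv ρ volume)] at h
  filter_upwards [h] with x hx hne
  refine hx fun h0 => hne ?_
  rw [density, h0, ENNReal.toReal_zero]

variable {g : Lp ℂ 2 ρ}

theorem isMulOp_star_density (hd : HasBoundedDensity ρ) (hg : g =ᵐ[ρ] fun _ => (1 : ℂ)) :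
    IsMulOp ρ volume (fun x => star (g x) * (density ρ x : ℂ))
      (mulOp ρ volume (fun x => star (g x) * (density ρ x : ℂ))) := by
  refine isMulOp_mulOp_from hd (k := fun x => star (g x)) (Lp.aestronglyMeasurable g).star 1 ?_
  filter_upwards [hg] with x hx
  simp [hx]

theorem isMulOp_coeFn (hd : HasBoundedDensity ρ) (hg : g =ᵐ[ρ] fun _ => (1 : ℂ)) :
    IsMulOp volume ρ g (mulOp volume ρ g) := by
  refine isMulOp_mulOp_to hd (Lp.aestronglyMeasurable g) 1 ?_
  filter_upwards [hg] with x hx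
  simp [hx]

theorem coeFn_mulOp_star_density (hd : HasBoundedDensity ρ) (hg : g =ᵐ[ρ] fun _ => (1 : ℂ))
    (f : Lp ℂ 2 ρ) :
    mulOp ρ volume (fun x => star (g x) * (density ρ x : ℂ)) f =ᵐ[volume]
      fun x => (ρ.rnDeriv volume x).toReal • f x := by
  filter_upwards [(isMulOp_star_density hd hg).coeFn f, hd.ae_of_ae hg] with x h1 h2
  rw [h1, Complex.real_smul]
  change _ = (density ρ x : ℂ) * f x
  by_cases h0 : density ρ x = 0
  · simp [h0]
  · simp [h2 h0]

theorem coeFn_mulOp_coeFn (hd : HasBoundedDensity ρ) (hg : g =ᵐ[ρ] fun _ => (1 : ℂ))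
    (u : Lp ℂ 2 (volume : Measure ℝ)) : mulOp volume ρ g u =ᵐ[ρ] u := by
  filter_upwards [(isMulOp_coeFn hd hg).coeFn u, hg] with x h1 h2
  rw [h1, h2, one_mul]

variable (g) in
/-- The operator `2 π i M_g P₊ M_{ḡ ρ̃}` in `L²(ρ)`: the boundary values from above of the Cauchy
integrals of `f ρ`. -/
noncomputable def cauchyOp : Lp ℂ 2 ρ →L[ℂ] Lp ℂ 2 ρ :=
  (2 * Real.pi * Complex.I : ℂ) • (mulOp volume ρ g ∘L rieszProj ∘L
    mulOp ρ volume (fun x => star (g x) * (density ρ x : ℂ)))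

theorem integrable_coeFn (f : Lp ℂ 2 ρ) : Integrable f ρ :=
  (Lp.memLp f).integrable one_le_two

/-- Sokhotski's formula applied to `f ρ̃`, which lies in `L¹ ∩ L²` of Lebesgue measure. -/
theorem exists_subseq_tendsto_cauchyOp (hd : HasBoundedDensity ρ)
    (hg : g =ᵐ[ρ] fun _ => (1 : ℂ)) (f : Lp ℂ 2 ρ) {ε : ℕ → ℝ} (hε : ∀ n, 0 < ε n)
    (hlim : Tendsto ε atTop (𝓝 0)) :
    ∃ ns : ℕ → ℕ, StrictMono ns ∧ ∀ᵐ (x : ℝ) ∂ρ,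
      Tendsto (fun n => ∫ t : ℝ, f t * ((t : ℂ) - (x + ε (ns n) * Complex.I))⁻¹ ∂ρ) atTop
        (𝓝 (cauchyOp g f x)) := by
  set w := mulOp ρ volume (fun x => star (g x) * (density ρ x : ℂ)) f with hw
  have hwae := coeFn_mulOp_star_density hd hg f
  have hint : Integrable w :=
    ((integrable_rnDeriv_smul_iff hd.1).mpr (integrable_coeFn f)).congr hwae.symm
  obtain ⟨ns, hns, h⟩ := exists_subseq_tendsto_cauchy hint (Lp.memLp w) hε hlim
  refine ⟨ns, hns, ?_⟩
  have hK : cauchyOp g f =ᵐ[ρ] fun x => 2 * Real.pi * Complex.I * rieszProj w x := by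
    have h1 : cauchyOp g f =
      (2 * Real.pi * Complex.I : ℂ) • mulOp volume ρ g (rieszProj w) := rfl
    rw [h1]
    filter_upwards [Lp.coeFn_smul (2 * Real.pi * Complex.I : ℂ) (mulOp volume ρ g (rieszProj w)),
      coeFn_mulOp_coeFn hd hg (rieszProj w)] with x h2 h3
    rw [h2, Pi.smul_apply, h3, smul_eq_mul]
  filter_upwards [hd.1.ae_le h, hK] with x hx h2
  rw [Lp.toLp_coeFn, ← h2] at hx
  refine hx.congr fun n => ?_
  rw [← integral_rnDeriv_smul hd.1]
  refine integral_congr_ae ?_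
  filter_upwards [hwae] with t ht
  rw [ht, smul_mul_assoc]

theorem add_ofReal_mul_I_im (x y : ℝ) : ((x : ℂ) + y * Complex.I).im = y := by simp

/-- Integrating `t/(t - z) = 1 + z/(t - z)` against `f ρ` and letting `z → x` from above; the
constant term is `∫ f dρ = (f, g)`. -/
theorem cauchyOp_posOp (hρ : IsCompact ρ.support) (hd : HasBoundedDensity ρ)
    (hg : g =ᵐ[ρ] fun _ => (1 : ℂ)) (f : Lp ℂ 2 ρ) :
    cauchyOp g (posOp ρ f) = posOp ρ (cauchyOp g f) + rankOnePert g f := by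
  obtain ⟨ns, hns, h1⟩ := exists_subseq_tendsto_cauchyOp hd hg f
    (fun n : ℕ => Nat.one_div_pos_of_nat (n := n)) tendsto_one_div_add_atTop_nhds_zero_nat
  -- Extracted inside the first subsequence, so that both limits hold along `ns ∘ ms`.
  obtain ⟨ms, hms, h2⟩ := exists_subseq_tendsto_cauchyOp hd hg (posOp ρ f)
    (ε := fun n => 1 / ((ns n : ℝ) + 1))
    (fun n => Nat.one_div_pos_of_nat)
    (tendsto_one_div_add_atTop_nhds_zero_nat.comp hns.tendsto_atTop)
  have hinner : inner ℂ g f = ∫ t, f t ∂ρ := by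
    rw [L2.inner_def]
    refine integral_congr_ae ?_
    filter_upwards [hg] with t ht
    simp [ht]
  refine Lp.ext ?_
  filter_upwards [h1, h2, Lp.coeFn_add (posOp ρ (cauchyOp g f)) (rankOnePert g f),
    (isMulOp_posOp hρ).coeFn (cauchyOp g f), Lp.coeFn_smul (inner ℂ g f : ℂ) g, hg]
    with x hx1 hx2 hx3 hx4 hx5 hx6
  have hB : rankOnePert g f = (inner ℂ g f : ℂ) • g := InnerProductSpace.rankOne_apply _ _ _
  rw [hx3, Pi.add_apply, hx4, hB, hx5, Pi.smul_apply, hx6, smul_eq_mul, mul_one, hinner]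
  refine tendsto_nhds_unique hx2 ?_
  have hε : Tendsto (fun n => (1 / ((ns (ms n) : ℝ) + 1))) atTop (𝓝 0) :=
    tendsto_one_div_add_atTop_nhds_zero_nat.comp (hns.comp hms).tendsto_atTop
  have hz : Tendsto (fun n => (x : ℂ) + (1 / ((ns (ms n) : ℝ) + 1) : ℝ) * Complex.I) atTop
      (𝓝 (x : ℂ)) := by
    have : Continuous fun e : ℝ => (x : ℂ) + e * Complex.I := by fun_prop
    have h0 := (this.tendsto 0).comp hε
    rw [Complex.ofReal_zero, zero_mul, add_zero] at h0
    exact h0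
  have hlim := (hz.mul (hx1.comp hms.tendsto_atTop)).add_const (∫ t, f t ∂ρ)
  refine hlim.congr fun n => ?_
  set z : ℂ := (x : ℂ) + (1 / ((ns (ms n) : ℝ) + 1) : ℝ) * Complex.I with hzdef
  have hzim : 0 < z.im := by
    rw [hzdef, add_ofReal_mul_I_im]
    exact Nat.one_div_pos_of_nat
  have hi := integrable_mul_inv_sub (integrable_coeFn f) hzim
  change z * (∫ t : ℝ, f t * ((t : ℂ) - z)⁻¹ ∂ρ) + ∫ t, f t ∂ρ = _
  rw [← integral_const_mul, ← integral_add (hi.const_mul z) (integrable_coeFn f)]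
  refine integral_congr_ae ?_
  filter_upwards [(isMulOp_posOp hρ).coeFn f] with t ht
  have hne : (t : ℂ) - z ≠ 0 := fun h0 => by
    have := congrArg Complex.im h0
    simp at this
    exact hzim.ne' this
  rw [ht]
  field_simp
  ring

/-- For `f = g` the Cauchy integrals are the Borel transform itself, so its bound passes to the
boundary values. -/
theorem ae_norm_cauchyOp_le (hd : HasBoundedDensity ρ) (hg : g =ᵐ[ρ] fun _ => (1 : ℂ)) {C : ℝ}
    (hC : ∀ z : ℂ, 0 < z.im → ‖borelTransform ρ z‖ ≤ C) : ∀ᵐ x ∂ρ, ‖cauchyOp g g x‖ ≤ C := by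
  obtain ⟨ns, -, h⟩ := exists_subseq_tendsto_cauchyOp hd hg g
    (fun n : ℕ => Nat.one_div_pos_of_nat (n := n)) tendsto_one_div_add_atTop_nhds_zero_nat
  filter_upwards [h] with x hx
  refine le_of_tendsto hx.norm (Eventually.of_forall fun n => ?_)
  have heq : ∫ t : ℝ, g t * ((t : ℂ) - (x + (1 / ((ns n : ℝ) + 1) : ℝ) * Complex.I))⁻¹ ∂ρ =
      borelTransform ρ (x + (1 / ((ns n : ℝ) + 1) : ℝ) * Complex.I) := by
    refine integral_congr_ae ?_
    filter_upwards [hg] with t ht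
    rw [ht, one_mul]
  rw [heq]
  refine hC _ ?_
  rw [add_ofReal_mul_I_im]
  exact Nat.one_div_pos_of_nat

/-- The formula of the derivative in terms of the Cauchy operator. -/
theorem derivOp_eq (hρ : IsCompact ρ.support) (hd : HasBoundedDensity ρ)
    (hg : g =ᵐ[ρ] fun _ => (1 : ℂ)) {M : ℝ} (hM : ρ.support ⊆ Set.Icc (-M) M) {φ : ℝ → ℂ}
    (hφ : ContinuousOn φ (Set.Icc (-M) M)) :
    derivOp ρ g M φ = cauchyOp g * funOp φ (posOp ρ) - funOp φ (posOp ρ) * cauchyOp g := by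
  set J := mulOp ρ volume (fun x => star (g x) * (density ρ x : ℂ)) with hJ
  set G := mulOp volume ρ g with hG
  set Z := mulOp volume volume (zeroExt M φ) with hZ
  have hA := isMulOp_funOp_posOp hρ hM hφ
  have hZm : IsMulOp volume volume (zeroExt M φ) Z := isMulOp_zeroExt hφ
  have hext : ∀ᵐ x ∂ρ, zeroExt M φ x = φ x := by
    filter_upwards [Measure.support_mem_ae (μ := ρ)] with x hx
    rw [zeroExt, Set.indicator_of_mem (hM hx)]
  -- Multiplication by `φ₀` on `L²(ℝ)` passes through `J`, and below through `G`, as `φ(A)`, since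
  -- `φ₀ = φ` `ρ`-a.e.
  have hZJ : ∀ f, Z (J f) = J (funOp φ (posOp ρ) f) := fun f => by
    refine Lp.ext ?_
    filter_upwards [hZm.coeFn (J f), coeFn_mulOp_star_density hd hg f,
      coeFn_mulOp_star_density hd hg (funOp φ (posOp ρ) f), hd.ae_of_ae hext,
      hd.ae_of_ae (hA.coeFn f)] with x h1 h2 h3 h4 h5
    rw [h1, h2, h3]
    change _ * density ρ x • f x = density ρ x • _
    by_cases h0 : density ρ x = 0
    · simp [h0]
    · rw [h4 h0, h5 h0, mul_smul_comm]
  have hGZ : ∀ u, G (Z u) = funOp φ (posOp ρ) (G u) := fun u => by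
    refine Lp.ext ?_
    filter_upwards [coeFn_mulOp_coeFn hd hg (Z u), hd.1.ae_le (hZm.coeFn u),
      hA.coeFn (G u), coeFn_mulOp_coeFn hd hg u, hext] with x h1 h2 h3 h4 h5
    rw [h1, h2, h3, h4, h5]
  ext1 f
  have h1 : derivOp ρ g M φ f = ((Real.pi : ℂ) * Complex.I) •
      G (rieszProj (Z (J f)) - (Z (J f) - rieszProj (Z (J f))) -
        Z (rieszProj (J f) - (J f - rieszProj (J f)))) := rfl
  have h2 : (cauchyOp g * funOp φ (posOp ρ) - funOp φ (posOp ρ) * cauchyOp g) f =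
      (2 * Real.pi * Complex.I : ℂ) • G (rieszProj (J (funOp φ (posOp ρ) f))) -
        funOp φ (posOp ρ) ((2 * Real.pi * Complex.I : ℂ) • G (rieszProj (J f))) := rfl
  -- The identity part of `H = 2P₊ - 1` drops out of the commutator, and the factor `2` turns `πi`
  -- into `2πi`.
  rw [h1, h2, ← hZJ, map_smul, ← hGZ]
  simp only [map_sub]
  module

end Cauchy

end GentlePert

/-! ### The commutator equation solved by `N = D - K`, and the conclusion. -/

theorem corollary4p10 (ρ : Measure ℝ) [IsFiniteMeasure ρ] (hρ : IsCompact ρ.support)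
    (g : Lp ℂ 2 ρ) (hg : g =ᵐ[ρ] fun _ => (1 : ℂ)) (hBTB : GentlePert.HasBTB ρ) :
    GentlePert.HasBoundedDensity ρ ∧
    GentlePert.HasFH (GentlePert.posOp ρ) (GentlePert.rankOnePert g) ∧
    ∀ M : ℝ, 0 < M → ρ.support ⊆ Set.Ioo (-M) M →
      (∀ᶠ γ : ℝ in 𝓝 0,
        spectrum ℂ (GentlePert.pert (GentlePert.posOp ρ) (GentlePert.rankOnePert g) (γ : ℂ)) ⊆
          (fun t : ℝ => (t : ℂ)) '' Set.Ioo (-M) M) ∧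
      ∀ φ : ℝ → ℂ, ContinuousOn φ (Set.Icc (-M) M) →
        HasDerivAt
          (fun γ : ℝ => GentlePert.funOp φ
            (GentlePert.pert (GentlePert.posOp ρ) (GentlePert.rankOnePert g) (γ : ℂ)))
          (GentlePert.derivOp ρ g M φ) 0 := by
  have hd := hBTB.hasBoundedDensity
  obtain ⟨C, hC⟩ := hBTB
  set A := GentlePert.posOp ρ with hAdef
  set B := GentlePert.rankOnePert g with hBdef
  set K := GentlePert.cauchyOp g with hKdef
  set D := GentlePert.mulOp ρ ρ (K g) with hDdef
  have hA : IsSelfAdjoint A := GentlePert.isSelfAdjoint_posOp hρ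
  have hB : IsSelfAdjoint B := GentlePert.isSelfAdjoint_rankOnePert g
  have hD : GentlePert.IsMulOp ρ ρ (K g) D := by
    refine GentlePert.isMulOp_mulOp (Lp.aestronglyMeasurable _) C.toNNReal ?_
    filter_upwards [GentlePert.ae_norm_cauchyOp_le hd hg hC] with x hx
    rw [← NNReal.coe_le_coe]
    exact hx.trans (Real.le_coe_toNNReal C)
  have hDA : D * A = A * D := by
    ext1 f
    refine Lp.ext ?_
    have hAm := GentlePert.isMulOp_posOp hρ
    filter_upwards [hD.coeFn (A f), hAm.coeFn f, hAm.coeFn (D f), hD.coeFn f] with x h1 h2 h3 h4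
    rw [mul_apply_eq_comp, mul_apply_eq_comp, h1, h2, h3, h4]
    ring
  have hKA : K * A = A * K + B := ContinuousLinearMap.ext (GentlePert.cauchyOp_posOp hρ hd hg)
  have hDg : D g = K g := by
    refine Lp.ext ?_
    filter_upwards [hD.coeFn g, hg] with x h1 h2
    rw [h1, h2, mul_one]
  have hNA : (D - K) * A - A * (D - K) = -B := by
    rw [sub_mul, mul_sub, hDA, hKA]
    abel
  -- The range of `B` is spanned by `g`, on which `D` and `K` agree.
  have hNB : (D - K) * B = 0 := by
    ext1 f
    have hBf : B f = (inner ℂ g f : ℂ) • g := InnerProductSpace.rankOne_apply _ _ _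
    rw [mul_apply_eq_comp, hBf, map_smul, sub_apply, hDg, sub_self, smul_zero]
    rfl
  have hσA := GentlePert.spectrum_posOp_subset hρ
  obtain ⟨R, hR⟩ := hρ.isBounded.subset_closedBall 0
  refine ⟨hd, GentlePert.hasFH_of_commutator hA hB hNA hNB
    (hσA.trans (Set.image_mono (hR.trans (Real.closedBall_eq_Icc).subset))),
    fun M _ hM => ⟨?_, fun φ hφ => ?_⟩⟩
  · filter_upwards [GentlePert.eventually_norm_ofReal_lt (D - K)] with γ hγ
    rw [GentlePert.spectrum_pert_eq hNA hNB hγ]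
    exact hσA.trans (Set.image_mono hM)
  · have hM' := hM.trans Set.Ioo_subset_Icc_self
    have hσ := hσA.trans (Set.image_mono hM')
    have h := GentlePert.hasDerivAt_funOp_pert hA hB hNA hNB hσ hφ
    -- `D` commutes with `φ(A)`, so only `K` contributes to the derivative.
    have hDφ := GentlePert.funOp_intertwine hA hA hDA hσ hσ hφ
    refine h.congr_deriv ?_
    rw [GentlePert.derivOp_eq hρ hd hg hM' hφ, mul_sub, sub_mul, hDφ]
    abel
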